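/- Let $\mathcal H$ be a complex Hilbert space with inner product antilinear in the first argument, and let $A\in\mathrm{Sym}^{(1,1)}_{\mathrm R}(\mathcal H)$. That is, $A$ is a densely defined, closed, symmetric operator in $\mathcal H$ with deficiency indices $(1,1)$, i.e. $\dim\ker(A^*\mp iI)=1$; it is simple (there is no nonzero closed invariant subspace on which $A$ is selfadjoint); and it is regular (for every $z\in\mathbb C$ there is $d_z>0$ with $\|(A-zI)\varphi\|\ge d_z\|\varphi\|$ for all $\varphi\in\operatorname{dom}A$). Let $A_\gamma$ be a selfadjoint extension of $A$ in $\mathcal H$. Let $g$ be a real entire function, i.e. $g(\bar z)=\overline{g(z)}$, whose set of zeros is the spectrum $\operatorname{Sp}(A_\gamma)$. Fix $z_0\in\mathbb C\setminus\operatorname{Sp}(A_\gamma)$ and $0\neq\psi_0\in\ker(A^*-z_0I)$. Put $$\psi(z)=(A_\gamma-z_0I)(A_\gamma-zI)^{-1}\psi_0,\qquad \xi(z)=g(z)\psi(z)\qquad(z\notin\operatorname{Sp}(A_\gamma)),$$ and extend $\xi$ to the points of $\operatorname{Sp}(A_\gamma)$ by its limits there. Put $$(\Phi\varphi)(z)=\langle\xi(\bar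 z),\varphi\rangle,\qquad\varphi\in\mathcal H,\ z\in\mathbb C,\qquad\text{and}\qquad\widehat{\mathcal H}=\Phi\mathcal H .$$ Then: 1. $\xi$ is an entire $\mathcal H$-valued function and $\xi(z)\in\ker(A^*-zI)$ for every $z\in\mathbb C$. 2. $\Phi$ is injective, so that $\langle\Phi\eta,\Phi\varphi\rangle_{\widehat{\mathcal H}}:=\langle\eta,\varphi\rangle$ defines an inner product on $\widehat{\mathcal H}$, and $\Phi$ is an isometry of $\mathcal H$ onto $\widehat{\mathcal H}$. 3. $\widehat{\mathcal H}$ with this inner product is an axiomatic de Branges space. That is, it is a nonzero linear space of entire functions, it is complete, and for every $f\in\widehat{\mathcal H}$: - (A1) for every non-real $w$, the linear functional $f\mapsto f(w)$ is continuous; - (A2) for every non-real zero $w$ of $f$, the function $f(z)(z-\bar w)(z-w)^{-1}$ belongs to $\widehat{\mathcal H}$ and has the same norm as $f$; - (A3) the function $f^\#(z)=\overline{f(\bar z)}$ belongs to $\widehat{\mathcal H}$ and has the same norm as $f$. 4. Let $S$ be the operator of multiplication by $z$ in $\widehat{\mathcal H}$, with $\operatorname{dom}S=\{f\in\widehat{\mathcal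 H}: zf\in\widehat{\mathcal H}\}$ and $(Sf)(z)=zf(z)$. Then $\operatorname{dom}S=\Phi\operatorname{dom}A$ and $S=\Phi A\Phi^{-1}$. -/

import Mathlib

open scoped ComplexConjugate Topology

noncomputable section

namespace DeBrangesRep

section Operators

variable {H : Type*} [NormedAddCommGroup H] [InnerProductSpace ℂ H]

/-- The map `x ↦ T x - z x`, defined on the domain of `T`. -/
def shift (T : H →ₗ.[ℂ] H) (z : ℂ) : T.domain →ₗ[ℂ] H :=
  T.toFun - z • T.domain.subtype

/-- `Ker (T - z)` as a subspace of `H`. -/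
def kerShift (T : H →ₗ.[ℂ] H) (z : ℂ) : Submodule ℂ H :=
  (LinearMap.ker (shift T z)).map T.domain.subtype

/-- `R`, a bounded operator from `H` into the domain of `T`, is the resolvent `(T - z)⁻¹`. -/
def IsResolventAt (T : H →ₗ.[ℂ] H) (z : ℂ) (R : H →L[ℂ] T.domain) : Prop :=
  (∀ x : H, shift T z (R x) = x) ∧ ∀ y : T.domain, R (shift T z y) = y

/-- The resolvent set of an unbounded operator. -/
def resolventSet (T : H →ₗ.[ℂ] H) : Set ℂ :=
  {z | ∃ R : H →L[ℂ] T.domain, IsResolventAt T z R}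

/-- The spectrum of an unbounded operator. -/
def spec (T : H →ₗ.[ℂ] H) : Set ℂ := (resolventSet T)ᶜ

open Classical in
/-- The resolvent `(T - z)⁻¹`, with values in the domain of `T` (zero when `z` is in the
spectrum). -/
def resolventAt (T : H →ₗ.[ℂ] H) (z : ℂ) : H →L[ℂ] T.domain :=
  if h : ∃ R : H →L[ℂ] T.domain, IsResolventAt T z R then h.choose else 0

/-- The generalized Cayley transform `ψ(z) = (T - z₀) (T - z)⁻¹ ψ₀`. -/
def cayley (T : H →ₗ.[ℂ] H) (z₀ : ℂ) (ψ₀ : H) (z : ℂ) : H :=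
  shift T z₀ (resolventAt T z ψ₀)

open Classical in
/-- The vector-valued function `ξ(z) = g(z) ψ(z)`; at the points of the spectrum of `T`, where
`ψ` has its singularities, the product is extended by its limit. -/
def xi (T : H →ₗ.[ℂ] H) (z₀ : ℂ) (ψ₀ : H) (g : ℂ → ℂ) (z : ℂ) : H :=
  if z ∈ spec T then
    Filter.limUnder (𝓝[≠] z) fun w => g w • cayley T z₀ ψ₀ w
  else g z • cayley T z₀ ψ₀ z

/-- The operator `B` in the subspace `N` is the part of `A` in `N`: its domain is
`dom A ∩ N`, and `A` maps `dom A ∩ N` into `N`, where it acts as `B`. -/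
def IsPartIn (A : H →ₗ.[ℂ] H) (N : Submodule ℂ H) (B : N →ₗ.[ℂ] N) : Prop :=
  (∀ x : N, x ∈ B.domain ↔ (x : H) ∈ A.domain) ∧
    ∀ (x : B.domain) (y : A.domain), ((x : N) : H) = (y : H) → ((B x : N) : H) = A y

/-- `A` is simple: there is no nonzero closed invariant subspace in which `A` is selfadjoint. -/
def IsSimpleOp (A : H →ₗ.[ℂ] H) : Prop :=
  ∀ (N : Submodule ℂ H) [CompleteSpace N] (B : N →ₗ.[ℂ] N),
    IsPartIn A N B → IsSelfAdjoint B → N = ⊥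

/-- `A` is regular: every complex number is a point of regular type for `A`. -/
def IsRegularOp (A : H →ₗ.[ℂ] H) : Prop :=
  ∀ z : ℂ, ∃ d : ℝ, 0 < d ∧ ∀ x : A.domain, d * ‖(x : H)‖ ≤ ‖shift A z x‖

/-- The class `Sym_R^{(1,1)}(H)` of simple, regular, closed, densely defined symmetric operators
with deficiency indices `(1,1)`. -/
structure IsSymR11 [CompleteSpace H] (A : H →ₗ.[ℂ] H) : Prop where
  dense_domain : Dense (A.domain : Set H)
  symmetric : A.IsFormalAdjoint A
  closed : A.IsClosed
  simple : IsSimpleOp A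
  regular : IsRegularOp A
  deficiency_pos : Module.finrank ℂ (kerShift A.adjoint Complex.I) = 1
  deficiency_neg : Module.finrank ℂ (kerShift A.adjoint (-Complex.I)) = 1

/-- The transform `(Φ φ)(z) = ⟨ξ(z̄), φ⟩` (inner product antilinear in the first argument). -/
def transform (ξ : ℂ → H) : H →ₗ[ℂ] (ℂ → ℂ) where
  toFun φ := fun z => inner ℂ (ξ (conj z)) φ
  map_add' φ η := by
    funext z
    exact inner_add_right _ _ _
  map_smul' a φ := by
    funext z
    exact inner_smul_right _ _ _

/-- The inner product carried over from `H` to the range of an injective linear map. -/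
@[reducible]
def transportCore {V : Type*} [AddCommGroup V] [Module ℂ V] (Φ : H →ₗ[ℂ] V)
    (hΦ : Function.Injective Φ) : InnerProductSpace.Core ℂ (LinearMap.range Φ) where
  inner f h := inner ℂ ((LinearEquiv.ofInjective Φ hΦ).symm f)
    ((LinearEquiv.ofInjective Φ hΦ).symm h)
  conj_inner_symm f h := inner_conj_symm _ _
  re_inner_nonneg f := inner_self_nonneg (𝕜 := ℂ)
  add_left f h k := by rw [map_add, inner_add_left]
  smul_left f h r := by rw [map_smul, inner_smul_left]
  definite f hf := by
    have h := inner_self_eq_zero (𝕜 := ℂ).mp hf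
    simpa using h

end Operators

section Spaces

/-- The norm generated by an inner product. -/
def coreNorm {V : Type*} [AddCommGroup V] [Module ℂ V] (c : InnerProductSpace.Core ℂ V)
    (f : V) : ℝ :=
  Real.sqrt (c.inner f f).re

/-- The uniform structure of the norm generated by an inner product. -/
@[reducible]
def coreUniformSpace {V : Type*} [AddCommGroup V] [Module ℂ V]
    (c : InnerProductSpace.Core ℂ V) : UniformSpace V :=
  c.toNormedAddCommGroup.toMetricSpace.toUniformSpace

/-- The linear manifold `B` of functions, with the inner product `c`, is an axiomatic
de Branges space. -/
structure IsDeBrangesSpace (B : Submodule ℂ (ℂ → ℂ)) (c : InnerProductSpace.Core ℂ B) :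
    Prop where
  nontrivial : B ≠ ⊥
  entire : ∀ f ∈ B, Differentiable ℂ f
  complete : @CompleteSpace B (coreUniformSpace c)
  /-- Evaluation at a non-real point is continuous. -/
  continuous_eval : ∀ w : ℂ, w.im ≠ 0 →
    @Continuous B ℂ (coreUniformSpace c).toTopologicalSpace _ fun f => (f : ℂ → ℂ) w
  /-- The entire function `f(z) (z - w̄) / (z - w)` is again in `B`, with the norm of `f`. -/
  move_zero : ∀ (f : B) (w : ℂ), w.im ≠ 0 → (f : ℂ → ℂ) w = 0 →
    ∃ h : B, (∀ z : ℂ, z ≠ w →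
      (h : ℂ → ℂ) z = (f : ℂ → ℂ) z * (z - conj w) * (z - w)⁻¹) ∧ coreNorm c h = coreNorm c f
  /-- The function `f^#(z) = conj (f (z̄))` is again in `B`, with the norm of `f`. -/
  sharp : ∀ f : B, ∃ h : B, (∀ z : ℂ, (h : ℂ → ℂ) z = conj ((f : ℂ → ℂ) (conj z))) ∧
    coreNorm c h = coreNorm c f

/-- Multiplication of functions by the independent variable. -/
def mulVar : (ℂ → ℂ) →ₗ[ℂ] (ℂ → ℂ) where
  toFun f := fun z => z * f z
  map_add' f h := by
    funext z
    exact mul_add _ _ _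
  map_smul' a f := by
    funext z
    exact mul_left_comm _ _ _

/-- The operator `S` of multiplication by `z` in `B`, with domain `{f ∈ B | z f ∈ B}`. -/
def mulOp (B : Submodule ℂ (ℂ → ℂ)) : B →ₗ.[ℂ] B where
  domain := B.comap (mulVar ∘ₗ B.subtype)
  toFun := (mulVar ∘ₗ B.subtype).restrict fun _ hf => hf

end Spaces

end DeBrangesRep

end

/-!
Let `T` be the selfadjoint extension, with resolvent `R(z) = (T - z)⁻¹`, and let
`U(z, w) = 1 + (z - w) R(z)` be its Cayley transforms (`cayleyOp`), so that `ψ(z) = U(z, z₀) ψ₀`.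

*The function `ξ` is entire.* The bounded operator `R(z)` is normal, hence its norm is its spectral
radius and is at most the inverse distance of `z` to the spectrum (`norm_boundedResolvent_le`). The
spectrum is the zero set of a nonzero entire function and so is discrete; therefore the
singularities of `ψ` are poles of order at most one, which the zeros of `g` remove
(`isBigO_smul_cayley`, `differentiable_xi`). Since `U(z, w)` maps `ker (A* - w)` bijectively onto
`ker (A* - z)`, the vector `ξ z` lies in `ker (A* - z)`, and spans it when `z` is not real
(`exists_eq_smul_xi`).

*Multiplication by `z`.* As `ξ (conj z)` is orthogonal to the range of `A - z`, the transform `Φ`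
turns `A - w` into multiplication by `z - w` (`transform_shift`); and for non-real `w` a vector `φ`
with `(Φ φ)(w) = 0` is of the form `(A - w) x`, since that range is closed
(`exists_shift_eq_of_transform_eq_zero`). Consequently `A` is selfadjoint in the kernel of `Φ`, so
that `Φ` is injective by simplicity (`eq_zero_of_transform_eq_zero`). The same two facts identify
the multiplication operator, and they give the axiom on moving zeros because
`‖(A - w) x‖ = ‖(A - conj w) x‖`.

*The conjugation.* Because the resolvents commute, `⟪ξ z, ξ w⟫ = ⟪ξ (conj w), ξ (conj z)⟫`
(`inner_xi_xi`). The vectors `ξ z` being complete, there is an antilinear isometry with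
`ξ z ↦ ξ (conj z)` (`exists_conjugate`), and `Φ` carries it to `f ↦ f^#`.
-/

namespace DeBrangesRep

/-! ### Symmetric operators and their shifts -/

section Shift

variable {H : Type*} [NormedAddCommGroup H] [InnerProductSpace ℂ H] {T : H →ₗ.[ℂ] H}

theorem shift_apply (T : H →ₗ.[ℂ] H) (z : ℂ) (x : T.domain) : shift T z x = T x - z • (x : H) :=
  rfl

theorem shift_eq_add (T : H →ₗ.[ℂ] H) (z w : ℂ) (x : T.domain) :
    shift T w x = shift T z x + (z - w) • (x : H) := by
  simp only [shift_apply]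
  module

theorem inner_shift_conj (hT : T.IsFormalAdjoint T) (z : ℂ) (x y : T.domain) :
    inner ℂ (shift T (conj z) x) (y : H) = inner ℂ (x : H) (shift T z y) := by
  simp only [shift_apply, inner_sub_left, inner_sub_right, inner_smul_left, inner_smul_right,
    hT x y, Complex.conj_conj]

theorem conj_inner_apply_self (hT : T.IsFormalAdjoint T) (x : T.domain) :
    conj (inner ℂ (T x) (x : H)) = inner ℂ (T x) (x : H) := by
  rw [inner_conj_symm, hT x x]

theorem norm_shift_conj (hT : T.IsFormalAdjoint T) (z : ℂ) (x : T.domain) :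
    ‖shift T (conj z) x‖ = ‖shift T z x‖ := by
  have him : (inner ℂ (T x) (x : H)).im = 0 := Complex.conj_eq_iff_im.1 (conj_inner_apply_self hT x)
  have h : ‖shift T (conj z) x‖ ^ 2 = ‖shift T z x‖ ^ 2 := by
    simp only [shift_apply, @norm_sub_sq ℂ, inner_smul_right, norm_smul, RCLike.norm_conj]
    simp [him]
  exact (sq_eq_sq₀ (norm_nonneg _) (norm_nonneg _)).1 h

theorem abs_im_mul_norm_le_norm_shift (hT : T.IsFormalAdjoint T) (z : ℂ) (x : T.domain) :
    |z.im| * ‖(x : H)‖ ≤ ‖shift T z x‖ := by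
  have him : (inner ℂ (T x) (x : H)).im = 0 := Complex.conj_eq_iff_im.1 (conj_inner_apply_self hT x)
  -- the imaginary part of `⟪x, (T - z) x⟫` comes from `z` alone, since `⟪x, T x⟫` is real
  have h1 : (inner ℂ (x : H) (shift T z x)).im = -(z.im * ‖(x : H)‖ ^ 2) := by
    rw [shift_apply, inner_sub_right, inner_smul_right, ← hT x x, Complex.sub_im, him,
      inner_self_eq_norm_sq_to_K, zero_sub]
    simp [← Complex.ofReal_pow]
  have h2 : |z.im| * ‖(x : H)‖ ^ 2 ≤ ‖(x : H)‖ * ‖shift T z x‖ := by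
    have := (Complex.abs_im_le_norm _).trans (norm_inner_le_norm (𝕜 := ℂ) (x : H) (shift T z x))
    rwa [h1, abs_neg, abs_mul, abs_of_nonneg (sq_nonneg ‖(x : H)‖)] at this
  rcases (norm_nonneg (x : H)).eq_or_lt with h0 | h0
  · rw [← h0, mul_zero]
    exact norm_nonneg _
  · nlinarith

theorem shift_injective_of_im_ne_zero (hT : T.IsFormalAdjoint T) {z : ℂ} (hz : z.im ≠ 0) :
    Function.Injective (shift T z) := by
  refine (injective_iff_map_eq_zero _).2 fun x hx => ?_
  have h := abs_im_mul_norm_le_norm_shift hT z x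
  rw [hx, norm_zero] at h
  have h' : ‖(x : H)‖ ≤ 0 := by
    by_contra! hc
    exact absurd h (not_le.2 (mul_pos (abs_pos.2 hz) hc))
  exact Subtype.ext (norm_le_zero_iff.1 h')

/-- A closed operator which is bounded below has closed range. -/
theorem isClosed_range_shift [CompleteSpace H] (hT : T.IsClosed) {z : ℂ} {d : ℝ} (hd : 0 < d)
    (hbd : ∀ x : T.domain, d * ‖(x : H)‖ ≤ ‖shift T z x‖) :
    IsClosed (LinearMap.range (shift T z) : Set H) := by
  refine isClosed_of_closure_subset fun y hy => ?_
  obtain ⟨u, hu, hlim⟩ := mem_closure_iff_seq_limit.1 hy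
  choose x hx using hu
  have hcau : CauchySeq fun n => (x n : H) := by
    refine Metric.cauchySeq_iff.2 fun ε hε => ?_
    obtain ⟨N, hN⟩ := Metric.cauchySeq_iff.1 hlim.cauchySeq (d * ε) (mul_pos hd hε)
    refine ⟨N, fun m hm n hn => ?_⟩
    have h1 := hN m hm n hn
    have h2 := hbd (x m - x n)
    rw [map_sub, hx, hx, ← dist_eq_norm] at h2
    rw [dist_eq_norm]
    exact lt_of_mul_lt_mul_left (h2.trans_lt h1) hd.le
  obtain ⟨x₀, hx₀⟩ := cauchySeq_tendsto_of_complete hcau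
  have hmem : (x₀, y + z • x₀) ∈ T.graph := by
    refine IsClosed.mem_of_tendsto hT (hx₀.prodMk_nhds (hlim.add (hx₀.const_smul z)))
      (Filter.Eventually.of_forall fun n => ?_)
    have : u n + z • (x n : H) = T (x n) := by
      rw [← hx, shift_apply, sub_add_cancel]
    rw [this]
    exact T.mem_graph (x n)
  obtain ⟨v, hv1, hv2⟩ := T.mem_graph_iff.1 hmem
  refine ⟨v, ?_⟩
  simp only [] at hv1 hv2
  rw [shift_apply, hv2, hv1, add_sub_cancel_right]

theorem exists_shift_eq [CompleteSpace H] (hsym : T.IsFormalAdjoint T) (hT : T.IsClosed) {z : ℂ}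
    (hz : z.im ≠ 0) {y : H}
    (hy : ∀ u : H, (∀ x : T.domain, inner ℂ u (shift T z x) = 0) → inner ℂ u y = 0) :
    ∃ x : T.domain, shift T z x = y := by
  have hcl : IsClosed (LinearMap.range (shift T z) : Set H) :=
    isClosed_range_shift hT (abs_pos.2 hz) (abs_im_mul_norm_le_norm_shift hsym z)
  have hcomp : CompleteSpace (LinearMap.range (shift T z)) := hcl.completeSpace_coe
  have hmem : y ∈ (LinearMap.range (shift T z))ᗮᗮ := fun u hu =>
    hy u fun x => Submodule.inner_left_of_mem_orthogonal (LinearMap.mem_range_self _ x) hu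
  rw [Submodule.orthogonal_orthogonal] at hmem
  exact hmem

theorem mem_kerShift {z : ℂ} {x : H} :
    x ∈ kerShift T z ↔ ∃ y : T.domain, (y : H) = x ∧ T y = z • x := by
  simp only [kerShift, Submodule.mem_map, LinearMap.mem_ker, Submodule.subtype_apply, shift_apply,
    sub_eq_zero]
  constructor
  · rintro ⟨y, h, rfl⟩
    exact ⟨y, rfl, h⟩
  · rintro ⟨y, rfl, h⟩
    exact ⟨y, h, rfl⟩

theorem mem_kerShift_adjoint [CompleteSpace H] (hd : Dense (T.domain : Set H)) {z : ℂ} {x : H} :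
    x ∈ kerShift T.adjoint z ↔ ∀ y : T.domain, inner ℂ x (shift T (conj z) y) = 0 := by
  simp only [mem_kerShift, shift_apply, inner_sub_right, inner_smul_right, sub_eq_zero]
  constructor
  · rintro ⟨v, rfl, hv⟩ y
    rw [← LinearPMap.adjoint_isFormalAdjoint hd v y, hv, inner_smul_left]
  · intro h
    have h' : ∀ y : T.domain, inner ℂ (z • x) (y : H) = inner ℂ x (T y) := fun y => by
      rw [h, inner_smul_left]
    exact ⟨⟨x, LinearPMap.mem_adjoint_domain_of_exists x ⟨_, h'⟩⟩, rfl,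
      LinearPMap.adjoint_apply_eq hd _ h'⟩

theorem isFormalAdjoint_of_isSelfAdjoint [CompleteSpace H] (hT : IsSelfAdjoint T) :
    T.IsFormalAdjoint T := by
  have h := LinearPMap.adjoint_isFormalAdjoint hT.dense_domain
  rwa [LinearPMap.isSelfAdjoint_def.1 hT] at h

theorem mem_resolventSet_of_im_ne_zero [CompleteSpace H] (hT : IsSelfAdjoint T) {z : ℂ}
    (hz : z.im ≠ 0) : z ∈ resolventSet T := by
  have hsym := isFormalAdjoint_of_isSelfAdjoint hT
  have hinj := shift_injective_of_im_ne_zero hsym hz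
  have hsurj : Function.Surjective (shift T z) := fun y => by
    refine exists_shift_eq hsym hT.isClosed hz fun u hu => ?_
    have hmem : u ∈ kerShift T.adjoint (conj z) :=
      (mem_kerShift_adjoint hT.dense_domain).2 fun x => by rw [Complex.conj_conj]; exact hu x
    rw [LinearPMap.isSelfAdjoint_def.1 hT, mem_kerShift] at hmem
    obtain ⟨v, rfl, hv⟩ := hmem
    have hv0 : v = 0 := shift_injective_of_im_ne_zero hsym (z := conj z) (by simpa using hz)
      (by rw [map_zero, shift_apply, hv, sub_self])
    simp [hv0]
  let e := LinearEquiv.ofBijective (shift T z) ⟨hinj, hsurj⟩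
  refine ⟨e.symm.toLinearMap.mkContinuous |z.im|⁻¹ fun x => ?_, fun x => ?_, fun y => ?_⟩
  · have h := abs_im_mul_norm_le_norm_shift hsym z (e.symm x)
    rw [show shift T z (e.symm x) = x from e.apply_symm_apply x] at h
    rw [inv_mul_eq_div, le_div_iff₀' (abs_pos.2 hz)]
    exact h
  · exact e.apply_symm_apply x
  · exact e.symm_apply_apply y

end Shift

/-! ### Resolvents -/

section Resolvent

variable {H : Type*} [NormedAddCommGroup H] [InnerProductSpace ℂ H] {T : H →ₗ.[ℂ] H}

/-- The resolvent `(T - z)⁻¹` as a bounded operator in the whole space; like `resolventAt`, it is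
zero when `z` is in the spectrum. -/
noncomputable def boundedResolvent (T : H →ₗ.[ℂ] H) (z : ℂ) : H →L[ℂ] H :=
  T.domain.subtypeL ∘L resolventAt T z

/-- The generalized Cayley transform `(T - w) (T - z)⁻¹` as a bounded operator, encoded as
`1 + (z - w) (T - z)⁻¹` to avoid the domain of `T`. -/
noncomputable def cayleyOp (T : H →ₗ.[ℂ] H) (z w : ℂ) : H →L[ℂ] H :=
  1 + (z - w) • boundedResolvent T z

theorem boundedResolvent_apply (T : H →ₗ.[ℂ] H) (z : ℂ) (x : H) :
    boundedResolvent T z x = resolventAt T z x :=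
  rfl

theorem cayleyOp_apply (T : H →ₗ.[ℂ] H) (z w : ℂ) (x : H) :
    cayleyOp T z w x = x + (z - w) • boundedResolvent T z x :=
  rfl

theorem notMem_spec_iff {z : ℂ} : z ∉ spec T ↔ z ∈ resolventSet T :=
  not_not

theorem isResolventAt_resolventAt {z : ℂ} (hz : z ∈ resolventSet T) :
    IsResolventAt T z (resolventAt T z) := by
  have h : ∃ R : H →L[ℂ] T.domain, IsResolventAt T z R := hz
  rw [resolventAt, dif_pos h]
  exact h.choose_spec

theorem shift_resolventAt {z : ℂ} (hz : z ∈ resolventSet T) (w : ℂ) (x : H) :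
    shift T w (resolventAt T z x) = cayleyOp T z w x := by
  rw [shift_eq_add T z w, (isResolventAt_resolventAt hz).1, cayleyOp_apply, boundedResolvent_apply]

/-- The first resolvent identity, `R(z) (1 + (w - z) R(w)) = R(w)`. -/
theorem boundedResolvent_mul_cayleyOp {z w : ℂ} (hz : z ∈ resolventSet T)
    (hw : w ∈ resolventSet T) :
    boundedResolvent T z * cayleyOp T w z = boundedResolvent T w := by
  ext x
  rw [mul_apply_eq_comp, ← shift_resolventAt hw, boundedResolvent_apply,
    (isResolventAt_resolventAt hz).2, boundedResolvent_apply]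

theorem boundedResolvent_sub {z w : ℂ} (hz : z ∈ resolventSet T) (hw : w ∈ resolventSet T) :
    boundedResolvent T w - boundedResolvent T z =
      (w - z) • (boundedResolvent T z * boundedResolvent T w) := by
  have h := boundedResolvent_mul_cayleyOp hz hw
  rw [cayleyOp, mul_add, mul_one, mul_smul_comm] at h
  rw [← h, add_sub_cancel_left]
  simp only [h]

theorem commute_boundedResolvent {z w : ℂ} (hz : z ∈ resolventSet T) (hw : w ∈ resolventSet T) :
    boundedResolvent T z * boundedResolvent T w = boundedResolvent T w * boundedResolvent T z := by
  rcases eq_or_ne z w with rfl | hne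
  · rfl
  have h1 := boundedResolvent_sub hz hw
  have h2 := boundedResolvent_sub hw hz
  have h3 : (w - z) • (boundedResolvent T z * boundedResolvent T w -
      boundedResolvent T w * boundedResolvent T z) = 0 := by
    rw [smul_sub, ← h1, ← neg_sub z w, neg_smul, ← h2]
    abel
  exact sub_eq_zero.1 ((smul_eq_zero.1 h3).resolve_left (sub_ne_zero.2 hne.symm))

theorem cayleyOp_mul_cayleyOp {z w : ℂ} (hz : z ∈ resolventSet T) (hw : w ∈ resolventSet T) :
    cayleyOp T z w * cayleyOp T w z = 1 := by
  have h : cayleyOp T z w * cayleyOp T w z =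
      cayleyOp T w z + (z - w) • (boundedResolvent T z * cayleyOp T w z) := by
    conv_lhs => rw [cayleyOp, add_mul, one_mul, smul_mul_assoc]
  rw [h, boundedResolvent_mul_cayleyOp hz hw, cayleyOp, add_assoc, ← add_smul]
  simp

theorem isUnit_cayleyOp {z w : ℂ} (hz : z ∈ resolventSet T) (hw : w ∈ resolventSet T) :
    IsUnit (cayleyOp T z w) :=
  ⟨⟨_, _, cayleyOp_mul_cayleyOp hz hw, cayleyOp_mul_cayleyOp hw hz⟩, rfl⟩

theorem inner_boundedResolvent (hT : T.IsFormalAdjoint T) {z : ℂ} (hz : z ∈ resolventSet T)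
    (hz' : conj z ∈ resolventSet T) (x y : H) :
    inner ℂ (boundedResolvent T z x) y = inner ℂ x (boundedResolvent T (conj z) y) := by
  have h := inner_shift_conj hT (conj z) (resolventAt T z x) (resolventAt T (conj z) y)
  rw [Complex.conj_conj, (isResolventAt_resolventAt hz).1, (isResolventAt_resolventAt hz').1] at h
  exact h.symm

theorem adjoint_boundedResolvent [CompleteSpace H] (hT : T.IsFormalAdjoint T) {z : ℂ}
    (hz : z ∈ resolventSet T) (hz' : conj z ∈ resolventSet T) :
    star (boundedResolvent T z) = boundedResolvent T (conj z) := by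
  symm
  rw [ContinuousLinearMap.star_eq_adjoint, ContinuousLinearMap.eq_adjoint_iff]
  intro x y
  have h := inner_boundedResolvent hT hz' (by rwa [Complex.conj_conj]) x y
  rwa [Complex.conj_conj] at h

theorem adjoint_cayleyOp [CompleteSpace H] (hT : T.IsFormalAdjoint T) {z : ℂ} (w : ℂ)
    (hz : z ∈ resolventSet T) (hz' : conj z ∈ resolventSet T) :
    star (cayleyOp T z w) = cayleyOp T (conj z) (conj w) := by
  rw [cayleyOp, star_add, star_one, star_smul, adjoint_boundedResolvent hT hz hz', cayleyOp]
  simp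

/-- The real symmetry of the Cayley transforms of a symmetric operator: after passing to the
adjoints, both sides are the same function of two commuting resolvents. -/
theorem inner_cayleyOp_cayleyOp [CompleteSpace H] (hT : T.IsFormalAdjoint T) {z w c : ℂ}
    (hz : z ∈ resolventSet T) (hz' : conj z ∈ resolventSet T) (hw : w ∈ resolventSet T)
    (hw' : conj w ∈ resolventSet T) (x : H) :
    inner ℂ (cayleyOp T z c x) (cayleyOp T w c x) =
      inner ℂ (cayleyOp T (conj w) c x) (cayleyOp T (conj z) c x) := by
  have key : cayleyOp T (conj z) (conj c) * cayleyOp T w c =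
      cayleyOp T w (conj c) * cayleyOp T (conj z) c := by
    have h1 := boundedResolvent_sub hw hz'
    have h2 := commute_boundedResolvent hw hz'
    have h3 : (c - conj c) • (boundedResolvent T (conj z) - boundedResolvent T w) =
        (c - conj c) • ((conj z - w) • (boundedResolvent T w * boundedResolvent T (conj z))) := by
      rw [h1]
    simp only [cayleyOp, mul_add, add_mul, mul_one, one_mul, smul_mul_assoc, mul_smul_comm, ← h2]
    rw [← sub_eq_zero] at h3 ⊢
    rw [← h3]
    module
  have h1 := adjoint_cayleyOp hT c hz hz'
  have h2 := adjoint_cayleyOp hT c hw' (by rwa [Complex.conj_conj])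
  rw [ContinuousLinearMap.star_eq_adjoint] at h1 h2
  rw [Complex.conj_conj] at h2
  rw [← ContinuousLinearMap.adjoint_inner_right, h1,
    ← ContinuousLinearMap.adjoint_inner_right (cayleyOp T (conj w) c), h2,
    ← mul_apply_eq_comp, key, mul_apply_eq_comp]

/-- The Cayley transform of an extension `T` of `A` carries `ker (A* - w)` into `ker (A* - z)`. -/
theorem cayleyOp_mem_kerShift_adjoint [CompleteSpace H] {A : H →ₗ.[ℂ] H}
    (hd : Dense (A.domain : Set H)) (hAT : A ≤ T) (hT : T.IsFormalAdjoint T) {z w : ℂ}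
    (hz : z ∈ resolventSet T) {x : H} (hx : x ∈ kerShift A.adjoint w) :
    cayleyOp T z w x ∈ kerShift A.adjoint z := by
  rw [mem_kerShift_adjoint hd] at hx ⊢
  intro y
  let y' : T.domain := ⟨y, hAT.1 y.2⟩
  have hy : shift A (conj z) y = shift T (conj z) y' := by
    rw [shift_apply, shift_apply, hAT.2 (x := y) (y := y') rfl]
  have h1 : inner ℂ (boundedResolvent T z x) (shift A (conj z) y) = inner ℂ x (y : H) := by
    have h := inner_shift_conj hT (conj z) (resolventAt T z x) y'
    rw [Complex.conj_conj, (isResolventAt_resolventAt hz).1, ← hy] at h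
    exact h.symm
  rw [cayleyOp_apply, inner_add_left, inner_smul_left, h1, map_sub, ← hx y,
    shift_eq_add A (conj z) (conj w), inner_add_right, inner_smul_right]

theorem cayley_eq_cayleyOp {z : ℂ} (hz : z ∈ resolventSet T) (w : ℂ) (x : H) :
    cayley T w x z = cayleyOp T z w x :=
  shift_resolventAt hz w x

theorem cayleyOp_ne_zero {z w : ℂ} (hz : z ∈ resolventSet T) (hw : w ∈ resolventSet T) {x : H}
    (hx : x ≠ 0) : cayleyOp T z w x ≠ 0 := fun h => hx <| by
  have := DFunLike.congr_fun (cayleyOp_mul_cayleyOp hw hz) x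
  rwa [mul_apply_eq_comp, h, map_zero, eq_comm] at this

end Resolvent

/-! ### Analyticity of the resolvent and the size of its poles -/

section Analytic

variable {H : Type*} [NormedAddCommGroup H] [InnerProductSpace ℂ H] [CompleteSpace H]
  {T : H →ₗ.[ℂ] H}

theorem differentiableAt_boundedResolvent {z : ℂ} (hz : resolventSet T ∈ 𝓝 z) :
    DifferentiableAt ℂ (boundedResolvent T) z := by
  have hz' := mem_of_mem_nhds hz
  -- `R(w) = R(z) (1 + (z - w) R(z))⁻¹` for `w` near `z`
  have heq : boundedResolvent T =ᶠ[𝓝 z]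
      fun w => boundedResolvent T z * Ring.inverse (cayleyOp T z w) := by
    filter_upwards [hz] with w hw
    have : Ring.inverse (cayleyOp T z w) = cayleyOp T w z :=
      Ring.inverse_unit ⟨_, _, cayleyOp_mul_cayleyOp hz' hw, cayleyOp_mul_cayleyOp hw hz'⟩
    rw [this, boundedResolvent_mul_cayleyOp hz' hw]
  refine DifferentiableAt.congr_of_eventuallyEq ?_ heq
  have h1 : DifferentiableAt ℂ (fun w => cayleyOp T z w) z := by
    unfold cayleyOp
    fun_prop
  exact ((differentiableAt_inverse (isUnit_cayleyOp hz' hz')).comp z h1).const_mul _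

theorem conj_mem_resolventSet (hT : IsSelfAdjoint T) {z : ℂ} (hz : z ∈ resolventSet T) :
    conj z ∈ resolventSet T := by
  by_cases h : z.im = 0
  · rwa [Complex.conj_eq_iff_im.2 h]
  · exact mem_resolventSet_of_im_ne_zero hT (by simpa using h)

/-- The resolvent of a selfadjoint operator is normal, so its norm is its spectral radius, which is
controlled by the distance to the spectrum. -/
theorem norm_boundedResolvent_le (hT : IsSelfAdjoint T) {z : ℂ} {r : ℝ} (hr : 0 < r)
    (hball : Metric.ball z r ⊆ resolventSet T) : ‖boundedResolvent T z‖ ≤ r⁻¹ := by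
  have hz : z ∈ resolventSet T := hball (Metric.mem_ball_self hr)
  have hz' := conj_mem_resolventSet hT hz
  have hnormal : IsStarNormal (boundedResolvent T z) := by
    refine ⟨?_⟩
    rw [adjoint_boundedResolvent (isFormalAdjoint_of_isSelfAdjoint hT) hz hz']
    exact commute_boundedResolvent hz' hz
  have hspec : ∀ k ∈ spectrum ℂ (boundedResolvent T z), ‖k‖ ≤ r⁻¹ := by
    intro k hk
    by_contra! hlt
    have hk0 : k ≠ 0 := norm_pos_iff.1 ((inv_pos.2 hr).trans hlt)
    -- a spectral value `k` of `R(z)` comes from the spectral value `z + 1 / k` of `T`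
    have hu : z + k⁻¹ ∈ resolventSet T := by
      refine hball ?_
      rw [mem_ball_iff_norm, add_sub_cancel_left, norm_inv]
      exact inv_lt_of_inv_lt₀ hr hlt
    refine hk (spectrum.mem_resolventSet_iff.2 ?_)
    have hsmul : algebraMap ℂ (H →L[ℂ] H) k - boundedResolvent T z =
        k • cayleyOp T z (z + k⁻¹) := by
      rw [cayleyOp, smul_add, smul_smul, Algebra.algebraMap_eq_smul_one]
      rw [show k * (z - (z + k⁻¹)) = -1 by field_simp; ring, neg_one_smul, sub_eq_add_neg]
    rw [hsmul]
    exact (isUnit_cayleyOp hz hu).smul (Units.mk0 k hk0)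
  have hrad : (‖boundedResolvent T z‖₊ : ENNReal) ≤ (r⁻¹.toNNReal : ENNReal) := by
    rw [← IsStarNormal.spectralRadius_eq_nnnorm]
    refine iSup₂_le fun k hk => ?_
    exact_mod_cast NNReal.le_toNNReal_of_coe_le (hspec k hk)
  have := (NNReal.coe_le_coe.2 (ENNReal.coe_le_coe.1 hrad))
  rwa [Real.coe_toNNReal _ (inv_pos.2 hr).le] at this

end Analytic

/-! ### The entire function `ξ` -/

section Xi

variable {H : Type*} [NormedAddCommGroup H] [InnerProductSpace ℂ H]
  {T : H →ₗ.[ℂ] H} {g : ℂ → ℂ} {z₀ : ℂ}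

theorem mem_resolventSet_iff_ne_zero (hzero : {z : ℂ | g z = 0} = spec T) {z : ℂ} :
    z ∈ resolventSet T ↔ g z ≠ 0 := by
  have h : g z = 0 ↔ z ∈ spec T := by rw [← hzero]; rfl
  rw [Ne, h, notMem_spec_iff]

theorem cayley_eq {w : ℂ} (hw : w ∈ resolventSet T) (ψ₀ : H) :
    cayley T z₀ ψ₀ w = ψ₀ + (w - z₀) • boundedResolvent T w ψ₀ :=
  cayley_eq_cayleyOp hw z₀ ψ₀

theorem isOpen_resolventSet (hg : Continuous g) (hzero : {z : ℂ | g z = 0} = spec T) :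
    IsOpen (resolventSet T) := by
  have : resolventSet T = {z | g z ≠ 0} := Set.ext fun _ => mem_resolventSet_iff_ne_zero hzero
  rw [this]
  exact isOpen_ne_fun hg continuous_const

theorem eventually_mem_resolventSet (hg : Differentiable ℂ g)
    (hzero : {z : ℂ | g z = 0} = spec T) (hz₀ : z₀ ∉ spec T) (z : ℂ) :
    ∀ᶠ w in 𝓝[≠] z, w ∈ resolventSet T := by
  simp only [mem_resolventSet_iff_ne_zero hzero]
  have han : AnalyticOnNhd ℂ g Set.univ := fun w _ => hg.analyticAt w
  by_contra h
  have h0 := han.eqOn_zero_of_preconnected_of_frequently_eq_zero isPreconnected_univ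
    (Set.mem_univ z) (fun h' => h (by simpa using h'))
  exact hz₀ (hzero ▸ h0 (Set.mem_univ z₀))

theorem xi_of_mem_resolventSet {z : ℂ} (hz : z ∈ resolventSet T) (ψ₀ : H) :
    xi T z₀ ψ₀ g z = g z • cayleyOp T z z₀ ψ₀ := by
  rw [xi, if_neg (notMem_spec_iff.2 hz), cayley_eq_cayleyOp hz]

theorem xi_ne_zero (hzero : {z : ℂ | g z = 0} = spec T) (hz₀ : z₀ ∉ spec T) {ψ₀ : H}
    (hψ₀ : ψ₀ ≠ 0) {z : ℂ} (hz : z ∈ resolventSet T) : xi T z₀ ψ₀ g z ≠ 0 := by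
  rw [xi_of_mem_resolventSet hz]
  exact smul_ne_zero ((mem_resolventSet_iff_ne_zero hzero).1 hz)
    (cayleyOp_ne_zero hz (notMem_spec_iff.1 hz₀) hψ₀)

variable [CompleteSpace H]

theorem differentiableAt_smul_cayley (hg : Differentiable ℂ g) {z : ℂ}
    (hz : resolventSet T ∈ 𝓝 z) (ψ₀ : H) :
    DifferentiableAt ℂ (fun w => g w • cayley T z₀ ψ₀ w) z := by
  have heq : (fun w => g w • cayley T z₀ ψ₀ w) =ᶠ[𝓝 z]
      fun w => g w • (ψ₀ + (w - z₀) • boundedResolvent T w ψ₀) := by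
    filter_upwards [hz] with w hw
    rw [cayley_eq hw]
  refine DifferentiableAt.congr_of_eventuallyEq ?_ heq
  have h1 := (differentiableAt_boundedResolvent hz).clm_apply (differentiableAt_const ψ₀)
  have h2 := hg.differentiableAt (x := z)
  fun_prop

/-- The poles of `ψ` are at most simple, so the zeros of `g` compensate them. -/
theorem isBigO_smul_cayley (hT : IsSelfAdjoint T) (hg : Differentiable ℂ g)
    (hzero : {z : ℂ | g z = 0} = spec T) (hz₀ : z₀ ∉ spec T) (ψ₀ : H) {p : ℂ} (hp : p ∈ spec T) :
    (fun w => g w • cayley T z₀ ψ₀ w) =O[𝓝[≠] p] fun _ => (1 : ℝ) := by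
  have hev := eventually_mem_resolventSet hg hzero hz₀ p
  obtain ⟨r, hr, hsub⟩ := Metric.mem_nhdsWithin_iff.1 hev
  have hR : (fun w => boundedResolvent T w ψ₀) =O[𝓝[≠] p] fun w => (w - p)⁻¹ := by
    refine Asymptotics.IsBigO.of_bound ‖ψ₀‖ ?_
    filter_upwards [self_mem_nhdsWithin,
      mem_nhdsWithin_of_mem_nhds (Metric.ball_mem_nhds p (half_pos hr))] with w hw hw'
    have hpos : 0 < ‖w - p‖ := norm_pos_iff.2 (sub_ne_zero.2 hw)
    have hball : Metric.ball w ‖w - p‖ ⊆ resolventSet T := by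
      intro u hu
      rw [mem_ball_iff_norm] at hu hw'
      refine hsub ⟨?_, fun h => ?_⟩
      · rw [mem_ball_iff_norm]
        calc ‖u - p‖ = ‖(u - w) + (w - p)‖ := by rw [sub_add_sub_cancel]
          _ ≤ ‖u - w‖ + ‖w - p‖ := norm_add_le _ _
          _ < r := by linarith
      · rw [Set.mem_singleton_iff.1 h, norm_sub_rev] at hu
        exact lt_irrefl _ hu
    calc ‖boundedResolvent T w ψ₀‖ ≤ ‖boundedResolvent T w‖ * ‖ψ₀‖ :=
          ContinuousLinearMap.le_opNorm _ _
      _ ≤ ‖w - p‖⁻¹ * ‖ψ₀‖ := by gcongr; exact norm_boundedResolvent_le hT hpos hball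
      _ = ‖ψ₀‖ * ‖(w - p)⁻¹‖ := by rw [norm_inv, mul_comm]
  have hgp : g p = 0 := by
    have : p ∈ {z : ℂ | g z = 0} := hzero ▸ hp
    exact this
  have hgO : g =O[𝓝[≠] p] fun w => w - p := by
    have := ((hg p).isBigO_sub).mono (nhdsWithin_le_nhds (s := {p}ᶜ))
    simpa [hgp] using this
  have h1 : (fun w => g w • ψ₀) =O[𝓝[≠] p] fun _ => (1 : ℝ) :=
    (((hg p).continuousAt.smul continuousAt_const).isBigO_one ℝ).mono nhdsWithin_le_nhds
  have h2 : (fun w => w - z₀) =O[𝓝[≠] p] fun _ => (1 : ℂ) :=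
    ((continuousAt_id.sub continuousAt_const).isBigO_one ℂ).mono nhdsWithin_le_nhds
  have h3 : (fun w => g w • ((w - z₀) • boundedResolvent T w ψ₀)) =O[𝓝[≠] p]
      fun _ => (1 : ℝ) := by
    refine (hgO.smul (h2.smul hR)).trans (Asymptotics.IsBigO.of_bound 1 ?_)
    filter_upwards [self_mem_nhdsWithin] with w hw
    have : w - p ≠ 0 := sub_ne_zero.2 hw
    simp [this]
  refine (h1.add h3).congr' ?_ Filter.EventuallyEq.rfl
  filter_upwards [hev] with w hw
  rw [cayley_eq hw, smul_add]

theorem differentiable_xi (hT : IsSelfAdjoint T) (hg : Differentiable ℂ g)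
    (hzero : {z : ℂ | g z = 0} = spec T) (hz₀ : z₀ ∉ spec T) (ψ₀ : H) :
    Differentiable ℂ (xi T z₀ ψ₀ g) := by
  have hopen := isOpen_resolventSet hg.continuous hzero
  intro p
  by_cases hp : p ∈ spec T
  · have hev := eventually_mem_resolventSet hg hzero hz₀ p
    let s : Set ℂ := insert p (resolventSet T)
    have hs : s ∈ 𝓝 p := insert_mem_nhds_iff.2 hev
    have hd : DifferentiableOn ℂ (fun w => g w • cayley T z₀ ψ₀ w) (s \ {p}) := fun w hw =>
      (differentiableAt_smul_cayley hg
        (hopen.mem_nhds (hw.1.resolve_left hw.2)) ψ₀).differentiableWithinAt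
    have hb : Filter.IsBoundedUnder (· ≤ ·) (𝓝[≠] p) fun w =>
        ‖g w • cayley T z₀ ψ₀ w - g p • cayley T z₀ ψ₀ p‖ :=
      (Asymptotics.isBigO_one_iff ℝ).1 ((isBigO_smul_cayley hT hg hzero hz₀ ψ₀ hp).sub
        (Asymptotics.isBigO_const_const _ one_ne_zero _))
    have h := (Complex.differentiableOn_update_limUnder_of_isLittleO hs hd
      hb.isLittleO_sub_self_inv).differentiableAt hs
    refine h.congr_of_eventuallyEq ?_
    filter_upwards [hs] with w hw
    rcases eq_or_ne w p with rfl | hne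
    · rw [Function.update_self, xi, if_pos hp]
    · rw [Function.update_of_ne hne, xi, if_neg (notMem_spec_iff.2 (hw.resolve_left hne))]
  · have hn : resolventSet T ∈ 𝓝 p := hopen.mem_nhds (notMem_spec_iff.1 hp)
    refine (differentiableAt_smul_cayley (z₀ := z₀) hg hn ψ₀).congr_of_eventuallyEq ?_
    filter_upwards [hn] with w hw
    rw [xi, if_neg (notMem_spec_iff.2 hw)]

theorem xi_mem_kerShift_adjoint {A : H →ₗ.[ℂ] H} (hd : Dense (A.domain : Set H)) (hAT : A ≤ T)
    (hT : IsSelfAdjoint T) (hg : Differentiable ℂ g) (hzero : {z : ℂ | g z = 0} = spec T)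
    (hz₀ : z₀ ∉ spec T) {ψ₀ : H} (hψ₀ : ψ₀ ∈ kerShift A.adjoint z₀) (z : ℂ) :
    xi T z₀ ψ₀ g z ∈ kerShift A.adjoint z := by
  have hres : ∀ w ∈ resolventSet T, xi T z₀ ψ₀ g w ∈ kerShift A.adjoint w := fun w hw => by
    rw [xi_of_mem_resolventSet hw]
    exact Submodule.smul_mem _ _
      (cayleyOp_mem_kerShift_adjoint hd hAT (isFormalAdjoint_of_isSelfAdjoint hT) hw hψ₀)
  refine (mem_kerShift_adjoint hd).2 fun y => ?_
  have hcont : Continuous fun w => inner ℂ (xi T z₀ ψ₀ g w) (shift A (conj w) y) := by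
    have h1 := (differentiable_xi hT hg hzero hz₀ ψ₀).continuous
    have h2 : Continuous fun w : ℂ => shift A (conj w) y := by
      simp only [shift_apply]
      fun_prop
    exact h1.inner h2
  have hlim : Filter.Tendsto (fun w => inner ℂ (xi T z₀ ψ₀ g w) (shift A (conj w) y)) (𝓝[≠] z)
      (𝓝 0) := by
    refine tendsto_const_nhds.congr' ?_
    filter_upwards [eventually_mem_resolventSet hg hzero hz₀ z] with w hw
    exact ((mem_kerShift_adjoint hd).1 (hres w hw) y).symm
  exact tendsto_nhds_unique (hcont.continuousAt.mono_left nhdsWithin_le_nhds) hlim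

/-- The defect subspaces at non-real points are lines, all isomorphic to the one at `i` under the
Cayley transform. -/
theorem exists_eq_smul_xi {A : H →ₗ.[ℂ] H} (hd : Dense (A.domain : Set H)) (hAT : A ≤ T)
    (hT : IsSelfAdjoint T) (hdef : Module.finrank ℂ (kerShift A.adjoint Complex.I) = 1)
    (hg : Differentiable ℂ g) (hzero : {z : ℂ | g z = 0} = spec T)
    (hz₀ : z₀ ∉ spec T) {ψ₀ : H} (hψ₀ : ψ₀ ∈ kerShift A.adjoint z₀) (hψ₀_ne : ψ₀ ≠ 0)
    {z : ℂ} (hz : z.im ≠ 0) {x : H} (hx : x ∈ kerShift A.adjoint z) :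
    ∃ c : ℂ, x = c • xi T z₀ ψ₀ g z := by
  have hsym := isFormalAdjoint_of_isSelfAdjoint hT
  have hz' : z ∈ resolventSet T := mem_resolventSet_of_im_ne_zero hT hz
  have hI : Complex.I ∈ resolventSet T := mem_resolventSet_of_im_ne_zero hT (by simp)
  have hmem : ∀ {y : H}, y ∈ kerShift A.adjoint z →
      cayleyOp T Complex.I z y ∈ kerShift A.adjoint Complex.I := fun hy =>
    cayleyOp_mem_kerShift_adjoint hd hAT hsym hI hy
  have hξ := xi_mem_kerShift_adjoint hd hAT hT hg hzero hz₀ hψ₀ z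
  have hne : (⟨_, hmem hξ⟩ : kerShift A.adjoint Complex.I) ≠ 0 := fun h =>
    cayleyOp_ne_zero hI hz' (xi_ne_zero hzero hz₀ hψ₀_ne hz') (congrArg Subtype.val h)
  obtain ⟨c, hc⟩ := (finrank_eq_one_iff_of_nonzero' _ hne).1 hdef ⟨_, hmem hx⟩
  have hc' : c • cayleyOp T Complex.I z (xi T z₀ ψ₀ g z) = cayleyOp T Complex.I z x :=
    congrArg Subtype.val hc
  have hinv : ∀ y : H, cayleyOp T z Complex.I (cayleyOp T Complex.I z y) = y := fun y =>
    DFunLike.congr_fun (cayleyOp_mul_cayleyOp hz' hI) y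
  refine ⟨c, ?_⟩
  rw [← hinv x, ← hc', map_smul, hinv]

theorem inner_xi_xi (hT : IsSelfAdjoint T) (hgreal : ∀ z : ℂ, g (conj z) = conj (g z))
    (ψ₀ : H) {z w : ℂ} (hz : z ∈ resolventSet T) (hw : w ∈ resolventSet T) :
    inner ℂ (xi T z₀ ψ₀ g z) (xi T z₀ ψ₀ g w) =
      inner ℂ (xi T z₀ ψ₀ g (conj w)) (xi T z₀ ψ₀ g (conj z)) := by
  have hz' := conj_mem_resolventSet hT hz
  have hw' := conj_mem_resolventSet hT hw
  simp only [xi_of_mem_resolventSet, hz, hw, hz', hw', inner_smul_left, inner_smul_right, hgreal,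
    Complex.conj_conj]
  rw [inner_cayleyOp_cayleyOp (isFormalAdjoint_of_isSelfAdjoint hT) hz hz' hw hw']
  ring

end Xi

/-! ### Parts of symmetric operators -/

section Part

variable {H : Type*} [NormedAddCommGroup H] [InnerProductSpace ℂ H]

/-- The basic criterion of selfadjointness. -/
theorem isSelfAdjoint_of_surjective_shift [CompleteSpace H] {B : H →ₗ.[ℂ] H}
    (hB : B.IsFormalAdjoint B) (h₁ : Function.Surjective (shift B Complex.I))
    (h₂ : Function.Surjective (shift B (-Complex.I))) : IsSelfAdjoint B := by
  have hconj : conj (-Complex.I) = Complex.I := by simp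
  have hswap : ∀ x y : B.domain,
      inner ℂ (shift B Complex.I x) (y : H) = inner ℂ (x : H) (shift B (-Complex.I) y) :=
    fun x y => by rw [← inner_shift_conj hB, hconj]
  have hzero : ∀ x : H, (∀ y : B.domain, inner ℂ x (shift B (-Complex.I) y) = 0) → x = 0 :=
    fun x hx => by
      obtain ⟨y, hy⟩ := h₂ x
      have h := hx y
      rw [hy] at h
      exact inner_self_eq_zero.1 h
  have hdense : Dense (B.domain : Set H) := by
    rw [Submodule.dense_iff_topologicalClosure_eq_top, Submodule.topologicalClosure_eq_top_iff,
      Submodule.eq_bot_iff]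
    intro x hx
    obtain ⟨y, rfl⟩ := h₁ x
    have hy : (y : H) = 0 := hzero _ fun u => by
      rw [← hswap]
      exact Submodule.inner_left_of_mem_orthogonal u.2 hx
    rw [show y = 0 from Subtype.ext hy, map_zero]
  rw [LinearPMap.isSelfAdjoint_def]
  refine (LinearPMap.eq_of_le_of_domain_eq (hB.le_adjoint hdense)
    (le_antisymm (hB.le_adjoint hdense).1 fun v hv => ?_)).symm
  obtain ⟨y, hy⟩ := h₁ (B.adjoint ⟨v, hv⟩ - Complex.I • v)
  have hvy : v - y = 0 := hzero _ fun u => by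
    rw [inner_sub_left, ← hswap, hy, shift_apply, inner_sub_left, inner_sub_right,
      LinearPMap.adjoint_isFormalAdjoint hdense ⟨v, hv⟩ u, inner_smul_left, inner_smul_right,
      Complex.conj_I, sub_self]
  rw [sub_eq_zero.1 hvy]
  exact y.2

/-- The part of `A` in an invariant subspace `N`: the restriction of `A` to `dom A ∩ N`. -/
def partIn (A : H →ₗ.[ℂ] H) (N : Submodule ℂ H)
    (hN : ∀ x : A.domain, (x : H) ∈ N → A x ∈ N) : N →ₗ.[ℂ] N where
  domain := A.domain.comap N.subtype
  toFun :=
    { toFun := fun x => ⟨A ⟨x, x.2⟩, hN _ (x : N).2⟩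
      map_add' := fun x y => Subtype.ext (A.map_add ⟨x, x.2⟩ ⟨y, y.2⟩)
      map_smul' := fun c x => Subtype.ext (A.map_smul c ⟨x, x.2⟩) }

theorem isPartIn_partIn (A : H →ₗ.[ℂ] H) (N : Submodule ℂ H)
    (hN : ∀ x : A.domain, (x : H) ∈ N → A x ∈ N) : IsPartIn A N (partIn A N hN) := by
  refine ⟨fun x => Iff.rfl, fun x y hxy => ?_⟩
  have : (⟨x, x.2⟩ : A.domain) = y := Subtype.ext hxy
  rw [← this]
  rfl

theorem partIn_isFormalAdjoint {A : H →ₗ.[ℂ] H} (hA : A.IsFormalAdjoint A) {N : Submodule ℂ H}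
    (hN : ∀ x : A.domain, (x : H) ∈ N → A x ∈ N) :
    (partIn A N hN).IsFormalAdjoint (partIn A N hN) :=
  fun x y => hA ⟨x, x.2⟩ ⟨y, y.2⟩

theorem surjective_shift_partIn {A : H →ₗ.[ℂ] H} {N : Submodule ℂ H}
    (hN : ∀ x : A.domain, (x : H) ∈ N → A x ∈ N) {z : ℂ}
    (h : ∀ y ∈ N, ∃ x : A.domain, (x : H) ∈ N ∧ shift A z x = y) :
    Function.Surjective (shift (partIn A N hN) z) := fun y => by
  obtain ⟨x, hx, hxy⟩ := h y y.2
  exact ⟨⟨⟨x, hx⟩, x.2⟩, Subtype.ext hxy⟩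

end Part

/-! ### Families of defect vectors -/

section Family

variable {H : Type*} [NormedAddCommGroup H] [InnerProductSpace ℂ H]
  {A : H →ₗ.[ℂ] H} {ξ : ℂ → H}

theorem dense_im_ne_zero : Dense {z : ℂ | z.im ≠ 0} :=
  (dense_compl_singleton (0 : ℝ)).preimage Complex.isOpenMap_im

theorem transform_apply (ξ : ℂ → H) (φ : H) (z : ℂ) :
    transform ξ φ z = inner ℂ (ξ (conj z)) φ :=
  rfl

theorem differentiable_transform (hξ : Differentiable ℂ ξ) (φ : H) :
    Differentiable ℂ (transform ξ φ) := by
  have h : Differentiable ℂ fun z => inner ℂ φ (ξ z) :=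
    (innerSL ℂ φ).differentiable.comp hξ
  have heq : transform ξ φ = conj ∘ (fun z => inner ℂ φ (ξ z)) ∘ conj := by
    funext z
    simp only [transform_apply, Function.comp_apply, inner_conj_symm]
  rw [heq]
  intro z
  have hz := (h (conj z)).conj_conj
  rwa [Complex.conj_conj] at hz

variable [CompleteSpace H]

/-- The transform turns `A - w` into multiplication by `z - w`. -/
theorem transform_shift (hd : Dense (A.domain : Set H)) (hker : ∀ z, ξ z ∈ kerShift A.adjoint z)
    (w : ℂ) (x : A.domain) (z : ℂ) :
    transform ξ (shift A w x) z = (z - w) * transform ξ x z := by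
  have h := (mem_kerShift_adjoint hd).1 (hker (conj z)) x
  rw [Complex.conj_conj] at h
  rw [transform_apply, shift_eq_add A z w, inner_add_right, h, zero_add, inner_smul_right,
    transform_apply]

theorem transform_apply_operator (hd : Dense (A.domain : Set H))
    (hker : ∀ z, ξ z ∈ kerShift A.adjoint z) (x : A.domain) (z : ℂ) :
    transform ξ (A x) z = z * transform ξ x z := by
  have h := transform_shift hd hker 0 x z
  rwa [shift_apply, zero_smul, sub_zero, sub_zero] at h

theorem exists_shift_eq_of_transform_eq_zero (hd : Dense (A.domain : Set H))
    (hA : A.IsFormalAdjoint A) (hcl : A.IsClosed)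
    (hspan : ∀ z : ℂ, z.im ≠ 0 → ∀ x ∈ kerShift A.adjoint z, ∃ c : ℂ, x = c • ξ z)
    {z : ℂ} (hz : z.im ≠ 0) {y : H} (hy : transform ξ y z = 0) :
    ∃ x : A.domain, shift A z x = y := by
  refine exists_shift_eq hA hcl hz fun u hu => ?_
  obtain ⟨c, rfl⟩ := hspan (conj z) (by simpa using hz) u
    ((mem_kerShift_adjoint hd).2 fun x => by rw [Complex.conj_conj]; exact hu x)
  rw [inner_smul_left, ← transform_apply, hy, mul_zero]

/-- The vectors orthogonal to all `ξ z` form a closed invariant subspace in which `A` is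
selfadjoint, so that simplicity makes the family `ξ` complete. -/
theorem eq_zero_of_transform_eq_zero (hd : Dense (A.domain : Set H))
    (hA : A.IsFormalAdjoint A) (hcl : A.IsClosed) (hsimple : IsSimpleOp A) (hξ : Differentiable ℂ ξ)
    (hker : ∀ z, ξ z ∈ kerShift A.adjoint z)
    (hspan : ∀ z : ℂ, z.im ≠ 0 → ∀ x ∈ kerShift A.adjoint z, ∃ c : ℂ, x = c • ξ z)
    {φ : H} (hφ : transform ξ φ = 0) : φ = 0 := by
  let N : Submodule ℂ H := LinearMap.ker (transform ξ)
  have hmemN : ∀ x : H, x ∈ N ↔ transform ξ x = 0 := fun x => LinearMap.mem_ker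
  have hNclosed : IsClosed (N : Set H) := by
    have : (N : Set H) = ⋂ z, {x | inner ℂ (ξ (conj z)) x = 0} := by
      ext x
      simp only [SetLike.mem_coe, hmemN, Set.mem_iInter, Set.mem_ofPred_eq, funext_iff,
        transform_apply, Pi.zero_apply]
    rw [this]
    exact isClosed_iInter fun z => isClosed_eq (by fun_prop) continuous_const
  have hNcomplete : CompleteSpace N := hNclosed.completeSpace_coe
  have hN : ∀ x : A.domain, (x : H) ∈ N → A x ∈ N := by
    intro x hx
    rw [hmemN] at hx ⊢
    funext z
    rw [transform_apply_operator hd hker, hx, Pi.zero_apply, mul_zero]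
  have hsurj : ∀ z : ℂ, z.im ≠ 0 → ∀ y ∈ N, ∃ x : A.domain, (x : H) ∈ N ∧ shift A z x = y := by
    intro z hz y hy
    rw [hmemN] at hy
    obtain ⟨x, rfl⟩ := exists_shift_eq_of_transform_eq_zero hd hA hcl hspan hz (congrFun hy z)
    refine ⟨x, (hmemN _).2 ?_, rfl⟩
    -- `(w - z) (Φ x)(w) = 0` for all `w`, hence `Φ x` vanishes off `z`, and at `z` by continuity
    refine (differentiable_transform hξ x).continuous.ext_on (dense_compl_singleton z)
      continuous_const fun w hw => ?_
    have h := congrFun hy w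
    rw [transform_shift hd hker, Pi.zero_apply] at h
    exact (mul_eq_zero.1 h).resolve_left (sub_ne_zero.2 hw)
  have hself : IsSelfAdjoint (partIn A N hN) :=
    isSelfAdjoint_of_surjective_shift (partIn_isFormalAdjoint hA hN)
      (surjective_shift_partIn hN (hsurj _ (by simp)))
      (surjective_shift_partIn hN (hsurj _ (by simp)))
  have hbot := hsimple N (partIn A N hN) (isPartIn_partIn A N hN) hself
  have := (hmemN φ).2 hφ
  rwa [hbot, Submodule.mem_bot] at this

end Family

/-! ### Conjugations -/

section Conjugation

variable {H : Type*} [NormedAddCommGroup H] [InnerProductSpace ℂ H] [CompleteSpace H]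
  {ι : Type*} {v v' : ι → H}

/-- If two families have conjugate Gram matrices and the first one is complete, then there is an
antilinear isometry `J` with `J (v i) = v' i`; the vector `η` is `J φ`. -/
theorem exists_conjugate (hgram : ∀ i j, inner ℂ (v i) (v j) = inner ℂ (v' j) (v' i))
    (hv : Dense (Submodule.span ℂ (Set.range v) : Set H)) (φ : H) :
    ∃ η : H, ‖η‖ = ‖φ‖ ∧ ∀ i, inner ℂ (v' i) η = inner ℂ φ (v i) := by
  let G : (ι →₀ ℂ) →ₗ[ℂ] H := Finsupp.linearCombination ℂ v
  let G' : (ι →₀ ℂ) →+ H := (Finsupp.linearCombination ℂ v').toAddMonoidHom.comp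
    (Finsupp.mapRange.addMonoidHom (starRingEnd ℂ).toAddMonoidHom)
  have hG : ∀ i a, G (Finsupp.single i a) = a • v i := fun i a =>
    Finsupp.linearCombination_single ℂ a i
  have hG' : ∀ i a, G' (Finsupp.single i a) = conj a • v' i := fun i a => by
    simp [G']
  have hinner : ∀ c d, inner ℂ (G c) (G d) = inner ℂ (G' d) (G' c) := by
    intro c d
    induction c using Finsupp.induction_linear with
    | zero => simp
    | add c₁ c₂ h₁ h₂ => simp only [map_add, inner_add_left, inner_add_right, h₁, h₂]
    | single i a =>
      induction d using Finsupp.induction_linear with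
      | zero => simp
      | add d₁ d₂ h₁ h₂ => simp only [map_add, inner_add_left, inner_add_right, h₁, h₂]
      | single j b =>
        simp only [hG, hG', inner_smul_left, inner_smul_right, hgram i j, Complex.conj_conj]
        ring
  have hnorm : ∀ c, ‖G' c‖ = ‖G c‖ := fun c => by
    rw [@norm_eq_sqrt_re_inner ℂ, @norm_eq_sqrt_re_inner ℂ, hinner]
  have hφ : φ ∈ closure (Set.range G) := by
    have : (Set.range G) = (Submodule.span ℂ (Set.range v) : Set H) := by
      rw [← Finsupp.range_linearCombination]
      rfl
    rw [this]
    exact hv φ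
  obtain ⟨u, hu, hlim⟩ := mem_closure_iff_seq_limit.1 hφ
  choose c hc using hu
  have hlim' : Filter.Tendsto (fun n => G (c n)) Filter.atTop (𝓝 φ) := by simpa only [hc] using hlim
  have hcau : CauchySeq fun n => G' (c n) := by
    refine Metric.cauchySeq_iff.2 fun ε hε => ?_
    obtain ⟨N, hN⟩ := Metric.cauchySeq_iff.1 hlim'.cauchySeq ε hε
    refine ⟨N, fun m hm n hn => ?_⟩
    rw [dist_eq_norm, ← map_sub, hnorm, map_sub, ← dist_eq_norm]
    exact hN m hm n hn
  obtain ⟨η, hη⟩ := cauchySeq_tendsto_of_complete hcau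
  refine ⟨η, ?_, fun i => ?_⟩
  · exact tendsto_nhds_unique hη.norm (by simpa only [hnorm] using hlim'.norm)
  · refine tendsto_nhds_unique ((tendsto_const_nhds (x := v' i)).inner hη) ?_
    have h : ∀ n, inner ℂ (v' i) (G' (c n)) = inner ℂ (G (c n)) (v i) := fun n => by
      have := hinner (c n) (Finsupp.single i 1)
      rw [hG, hG', map_one, one_smul, one_smul] at this
      exact this.symm
    simp only [h]
    exact hlim'.inner tendsto_const_nhds

end Conjugation

/-! ### The transported inner product -/

section Transport

variable {H : Type*} [NormedAddCommGroup H] [InnerProductSpace ℂ H]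
  {V : Type*} [AddCommGroup V] [Module ℂ V] (Φ : H →ₗ[ℂ] V) (hΦ : Function.Injective Φ)

theorem ofInjective_symm_rangeRestrict (φ : H) :
    (LinearEquiv.ofInjective Φ hΦ).symm (Φ.rangeRestrict φ) = φ :=
  (LinearEquiv.ofInjective Φ hΦ).symm_apply_apply φ

theorem transportCore_inner_rangeRestrict (η φ : H) :
    (transportCore Φ hΦ).inner (Φ.rangeRestrict η) (Φ.rangeRestrict φ) = inner ℂ η φ := by
  change inner ℂ ((LinearEquiv.ofInjective Φ hΦ).symm (Φ.rangeRestrict η))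
    ((LinearEquiv.ofInjective Φ hΦ).symm (Φ.rangeRestrict φ)) = _
  rw [ofInjective_symm_rangeRestrict, ofInjective_symm_rangeRestrict]

theorem coreNorm_rangeRestrict (φ : H) :
    coreNorm (transportCore Φ hΦ) (Φ.rangeRestrict φ) = ‖φ‖ := by
  rw [coreNorm, transportCore_inner_rangeRestrict, @norm_eq_sqrt_re_inner ℂ]
  rfl

/-- For the transported norm, `Φ` is an isometry of `H` onto its range. -/
theorem exists_isometryEquiv_rangeRestrict :
    letI : NormedAddCommGroup (LinearMap.range Φ) := (transportCore Φ hΦ).toNormedAddCommGroup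
    ∃ e : H ≃ᵢ LinearMap.range Φ, ⇑e = Φ.rangeRestrict := by
  let : NormedAddCommGroup (LinearMap.range Φ) := (transportCore Φ hΦ).toNormedAddCommGroup
  have hiso : Isometry Φ.rangeRestrict :=
    AddMonoidHomClass.isometry_of_norm Φ.rangeRestrict (coreNorm_rangeRestrict Φ hΦ)
  exact ⟨IsometryEquiv.mk ((LinearEquiv.ofInjective Φ hΦ).toEquiv) hiso, rfl⟩

theorem completeSpace_transportCore [CompleteSpace H] :
    @CompleteSpace (LinearMap.range Φ) (coreUniformSpace (transportCore Φ hΦ)) := by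
  let : NormedAddCommGroup (LinearMap.range Φ) := (transportCore Φ hΦ).toNormedAddCommGroup
  obtain ⟨e, -⟩ := exists_isometryEquiv_rangeRestrict Φ hΦ
  exact e.completeSpace_iff.1 inferInstance

theorem continuous_transportCore {X : Type*} [TopologicalSpace X] {f : LinearMap.range Φ → X}
    (hf : Continuous fun φ => f (Φ.rangeRestrict φ)) :
    @Continuous (LinearMap.range Φ) X
      (coreUniformSpace (transportCore Φ hΦ)).toTopologicalSpace _ f := by
  let : NormedAddCommGroup (LinearMap.range Φ) := (transportCore Φ hΦ).toNormedAddCommGroup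
  obtain ⟨e, he⟩ := exists_isometryEquiv_rangeRestrict Φ hΦ
  rw [← e.comp_continuous_iff']
  rwa [he]

end Transport

/-! ### The space of transforms -/

section Range

variable {H : Type*} [NormedAddCommGroup H] [InnerProductSpace ℂ H] [CompleteSpace H]
  {A : H →ₗ.[ℂ] H} {ξ : ℂ → H}

/-- The conjugation `ξ z ↦ ξ (conj z)` realizes `f ↦ f^#` on transforms. -/
theorem exists_transform_eq_conj (hξ : Differentiable ℂ ξ)
    (hinj : Function.Injective (transform ξ))
    (hgram : ∀ z w : ℂ, z.im ≠ 0 → w.im ≠ 0 →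
      inner ℂ (ξ z) (ξ w) = inner ℂ (ξ (conj w)) (ξ (conj z))) (φ : H) :
    ∃ η : H, ‖η‖ = ‖φ‖ ∧ ∀ z, transform ξ η z = conj (transform ξ φ (conj z)) := by
  let v : {z : ℂ // z.im ≠ 0} → H := fun z => ξ z
  have hv : Dense (Submodule.span ℂ (Set.range v) : Set H) := by
    rw [Submodule.dense_iff_topologicalClosure_eq_top, Submodule.topologicalClosure_eq_top_iff,
      Submodule.eq_bot_iff]
    intro x hx
    refine (injective_iff_map_eq_zero _).1 hinj x ?_
    refine (differentiable_transform hξ x).continuous.ext_on dense_im_ne_zero continuous_const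
      fun z hz => ?_
    exact hx _ (Submodule.subset_span ⟨⟨conj z, by simpa using hz⟩, rfl⟩)
  obtain ⟨η, hnorm, hη⟩ := exists_conjugate (v := v) (v' := fun z => ξ (conj (z : ℂ)))
    (fun z w => hgram z w z.2 w.2) hv φ
  refine ⟨η, hnorm, congrFun (Continuous.ext_on dense_im_ne_zero
    (differentiable_transform hξ η).continuous ?_ fun z hz => ?_)⟩
  · have := (differentiable_transform hξ φ).continuous
    exact Complex.continuous_conj.comp (this.comp Complex.continuous_conj)
  · simp only [transform_apply, Complex.conj_conj, inner_conj_symm]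
    exact hη ⟨z, hz⟩

theorem isDeBrangesSpace_range_transform (hd : Dense (A.domain : Set H))
    (hA : A.IsFormalAdjoint A) (hcl : A.IsClosed) (hξ : Differentiable ℂ ξ)
    (hker : ∀ z, ξ z ∈ kerShift A.adjoint z)
    (hspan : ∀ z : ℂ, z.im ≠ 0 → ∀ x ∈ kerShift A.adjoint z, ∃ c : ℂ, x = c • ξ z)
    (hgram : ∀ z w : ℂ, z.im ≠ 0 → w.im ≠ 0 →
      inner ℂ (ξ z) (ξ w) = inner ℂ (ξ (conj w)) (ξ (conj z)))
    (hinj : Function.Injective (transform ξ)) {x₀ : H} (hx₀ : x₀ ≠ 0) :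
    IsDeBrangesSpace (LinearMap.range (transform ξ)) (transportCore (transform ξ) hinj) where
  nontrivial h := hx₀ (hinj (by
    rw [map_zero, LinearMap.range_eq_bot.1 h, LinearMap.zero_apply]))
  entire := by
    rintro _ ⟨φ, rfl⟩
    exact differentiable_transform hξ φ
  complete := completeSpace_transportCore _ hinj
  continuous_eval w _ := continuous_transportCore _ hinj <| by
    change Continuous fun φ => inner ℂ (ξ (conj w)) φ
    fun_prop
  move_zero := by
    rintro ⟨_, φ, rfl⟩ w hw hfw
    obtain ⟨x, rfl⟩ := exists_shift_eq_of_transform_eq_zero hd hA hcl hspan hw hfw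
    refine ⟨(transform ξ).rangeRestrict (shift A (conj w) x), fun z hz => ?_, ?_⟩
    · change transform ξ (shift A (conj w) x) z = transform ξ (shift A w x) z * _ * _
      rw [transform_shift hd hker, transform_shift hd hker]
      field_simp [sub_ne_zero.2 hz]
    · rw [coreNorm_rangeRestrict, norm_shift_conj hA]
      exact (coreNorm_rangeRestrict _ hinj _).symm
  sharp := by
    rintro ⟨_, φ, rfl⟩
    obtain ⟨η, hnorm, hη⟩ := exists_transform_eq_conj hξ hinj hgram φ
    refine ⟨(transform ξ).rangeRestrict η, hη, ?_⟩
    rw [coreNorm_rangeRestrict, hnorm]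
    exact (coreNorm_rangeRestrict _ hinj _).symm

theorem mulOp_apply (B : Submodule ℂ (ℂ → ℂ)) (f : (mulOp B).domain) (z : ℂ) :
    (mulOp B f : ℂ → ℂ) z = z * (f : B).1 z :=
  rfl

theorem rangeRestrict_mem_domain_mulOp_iff (hd : Dense (A.domain : Set H))
    (hA : A.IsFormalAdjoint A) (hcl : A.IsClosed) (hξ : Differentiable ℂ ξ)
    (hker : ∀ z, ξ z ∈ kerShift A.adjoint z)
    (hspan : ∀ z : ℂ, z.im ≠ 0 → ∀ x ∈ kerShift A.adjoint z, ∃ c : ℂ, x = c • ξ z)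
    (hinj : Function.Injective (transform ξ)) (φ : H) :
    (transform ξ).rangeRestrict φ ∈ (mulOp (LinearMap.range (transform ξ))).domain ↔
      φ ∈ A.domain := by
  constructor
  · rintro ⟨η, hη⟩
    have hη' : ∀ z, transform ξ η z = z * transform ξ φ z := fun z => congrFun hη z
    have hzero : transform ξ (η - Complex.I • φ) Complex.I = 0 := by
      simp [hη']
    obtain ⟨x, hx⟩ := exists_shift_eq_of_transform_eq_zero hd hA hcl hspan (by simp) hzero
    -- `(z - i) (Φ x)(z) = (z - i) (Φ φ)(z)`, so the entire functions `Φ x` and `Φ φ` coincide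
    have hxφ : (x : H) = φ := hinj <| by
      refine (differentiable_transform hξ _).continuous.ext_on (dense_compl_singleton Complex.I)
        (differentiable_transform hξ _).continuous fun z hz => ?_
      refine mul_left_cancel₀ (sub_ne_zero.2 hz) ?_
      rw [← transform_shift hd hker, hx, map_sub, map_smul, Pi.sub_apply, Pi.smul_apply, hη',
        smul_eq_mul, sub_mul]
    rw [← hxφ]
    exact x.2
  · intro hφ
    exact ⟨A ⟨φ, hφ⟩, funext fun z => transform_apply_operator hd hker ⟨φ, hφ⟩ z⟩

theorem mulOp_rangeRestrict (hd : Dense (A.domain : Set H))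
    (hker : ∀ z, ξ z ∈ kerShift A.adjoint z) (φ : A.domain)
    (f : (mulOp (LinearMap.range (transform ξ))).domain)
    (hf : (f : LinearMap.range (transform ξ)) = (transform ξ).rangeRestrict (φ : H)) :
    mulOp (LinearMap.range (transform ξ)) f = (transform ξ).rangeRestrict (A φ) := by
  refine Subtype.ext (funext fun z => ?_)
  rw [mulOp_apply, hf]
  exact (transform_apply_operator hd hker φ z).symm

end Range

end DeBrangesRep

theorem mainTheorem5 {H : Type*} [NormedAddCommGroup H] [InnerProductSpace ℂ H] [CompleteSpace H]
    (A : H →ₗ.[ℂ] H) (hA : DeBrangesRep.IsSymR11 A)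
    -- a selfadjoint extension of `A`
    (Aγ : H →ₗ.[ℂ] H) (hext : A ≤ Aγ) (hself : IsSelfAdjoint Aγ)
    -- a real entire function whose zero-set is the spectrum of the extension
    (g : ℂ → ℂ) (hg : Differentiable ℂ g)
    (hgreal : ∀ z : ℂ, g ((starRingEnd ℂ) z) = (starRingEnd ℂ) (g z))
    (hgzero : {z : ℂ | g z = 0} = DeBrangesRep.spec Aγ)
    -- the data of the generalized Cayley transform
    (z₀ : ℂ) (hz₀ : z₀ ∉ DeBrangesRep.spec Aγ)
    (ψ₀ : H) (hψ₀ : ψ₀ ∈ DeBrangesRep.kerShift A.adjoint z₀) (hψ₀_ne : ψ₀ ≠ 0)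
    (ξ : ℂ → H) (hξ : ξ = DeBrangesRep.xi Aγ z₀ ψ₀ g)
    (Φ : H →ₗ[ℂ] (ℂ → ℂ)) (hΦ : Φ = DeBrangesRep.transform ξ) :
    -- `ξ` is entire, with values in the kernels of `A* - z`
    Differentiable ℂ ξ ∧ (∀ z : ℂ, ξ z ∈ DeBrangesRep.kerShift A.adjoint z) ∧
    -- `Φ` is injective, so its range inherits the inner product of `H`
    ∃ hinj : Function.Injective Φ,
      -- the range is an axiomatic de Branges space
      DeBrangesRep.IsDeBrangesSpace (LinearMap.range Φ) (DeBrangesRep.transportCore Φ hinj) ∧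
      -- `Φ` is an isometry onto its range
      Function.Bijective Φ.rangeRestrict ∧
      (∀ η φ : H, (DeBrangesRep.transportCore Φ hinj).inner (Φ.rangeRestrict η)
        (Φ.rangeRestrict φ) = inner ℂ η φ) ∧
      -- `A` becomes the operator of multiplication by `z`, domains included
      (∀ φ : H, Φ.rangeRestrict φ ∈ (DeBrangesRep.mulOp (LinearMap.range Φ)).domain ↔
        φ ∈ A.domain) ∧
      ∀ (φ : A.domain) (f : (DeBrangesRep.mulOp (LinearMap.range Φ)).domain),
        (f : LinearMap.range Φ) = Φ.rangeRestrict (φ : H) →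
          DeBrangesRep.mulOp (LinearMap.range Φ) f = Φ.rangeRestrict (A φ) := by
  have hd := hA.dense_domain
  have hpoint : ∀ {z : ℂ}, z.im ≠ 0 → z ∈ DeBrangesRep.resolventSet Aγ := fun hz =>
    DeBrangesRep.mem_resolventSet_of_im_ne_zero hself hz
  have hdiff : Differentiable ℂ ξ := by
    rw [hξ]
    exact DeBrangesRep.differentiable_xi hself hg hgzero hz₀ ψ₀
  have hker : ∀ z, ξ z ∈ DeBrangesRep.kerShift A.adjoint z := by
    rw [hξ]
    exact DeBrangesRep.xi_mem_kerShift_adjoint hd hext hself hg hgzero hz₀ hψ₀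
  have hspan : ∀ z : ℂ, z.im ≠ 0 → ∀ x ∈ DeBrangesRep.kerShift A.adjoint z,
      ∃ c : ℂ, x = c • ξ z := by
    rw [hξ]
    exact fun z hz x hx => DeBrangesRep.exists_eq_smul_xi hd hext hself hA.deficiency_pos hg hgzero
      hz₀ hψ₀ hψ₀_ne hz hx
  have hgram : ∀ z w : ℂ, z.im ≠ 0 → w.im ≠ 0 →
      inner ℂ (ξ z) (ξ w) = inner ℂ (ξ (starRingEnd ℂ w)) (ξ (starRingEnd ℂ z)) := by
    rw [hξ]
    exact fun z w hz hw => DeBrangesRep.inner_xi_xi hself hgreal ψ₀ (hpoint hz) (hpoint hw)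
  subst hΦ
  have hinj : Function.Injective (DeBrangesRep.transform ξ) :=
    (injective_iff_map_eq_zero _).2 fun φ hφ => DeBrangesRep.eq_zero_of_transform_eq_zero hd
      hA.symmetric hA.closed hA.simple hdiff hker hspan hφ
  exact ⟨hdiff, hker, hinj,
    DeBrangesRep.isDeBrangesSpace_range_transform hd hA.symmetric hA.closed hdiff hker hspan hgram
      hinj hψ₀_ne,
    ⟨fun _ _ h => hinj (congrArg Subtype.val h), LinearMap.surjective_rangeRestrict _⟩,
    DeBrangesRep.transportCore_inner_rangeRestrict _ hinj,
    DeBrangesRep.rangeRestrict_mem_domain_mulOp_iff hd hA.symmetric hA.closed hdiff hker hspan hinj,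
    DeBrangesRep.mulOp_rangeRestrict hd hker⟩
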